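/- For positive integers $k$ and $n$ let $$r_k^{1(2)}(n) := \bigl|\{(x_1,\dots,x_k) \;:\; x_1,\dots,x_k \text{ strictly positive odd integers},\ n = x_1^2+\cdots+x_k^2\}\bigr|$$ be the number of ordered representations of $n$ as a sum of $k$ squares of positive odd integers. Then for every integer $m \ge 0$, $$r_4^{1(2)}(8m+4) = \sum_{d \mid 2m+1} d,$$ where the sum runs over all positive divisors $d$ of $2m+1$. -/

import Mathlib

/-- `ℕ^{a(b)}`: the set of strictly positive integers congruent to `a` modulo `b`. -/
def posCongr (a b : ℕ) : Set ℕ := {x | 0 < x ∧ x ≡ a [MOD b]}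

/-- The ordered `k`-tuples of strictly positive odd integers whose squares sum to `n`. -/
def oddSquareTuples (k n : ℕ) : Set (Fin k → ℕ) :=
  {x | (∀ i, x i ∈ posCongr 1 2) ∧ n = ∑ i, x i ^ 2}

/-- There are only finitely many such tuples, so that counting them is meaningful. -/
theorem oddSquareTuples_finite (k n : ℕ) : (oddSquareTuples k n).Finite := by
  refine (Set.finite_Iic (fun _ : Fin k => n)).subset ?_
  rintro x ⟨-, hx⟩ i
  have h1 : x i ^ 2 ≤ ∑ j, x j ^ 2 :=
    Finset.single_le_sum (f := fun j => x j ^ 2) (fun _ _ => Nat.zero_le _) (Finset.mem_univ i)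
  have h2 : x i ≤ x i ^ 2 := Nat.le_self_pow two_ne_zero _
  show x i ≤ n
  omega

/-- `r_k^{1(2)}(n)`: the number of ordered representations of `n` as a sum of `k` squares of
strictly positive odd integers. -/
noncomputable def oddSquareRep (k n : ℕ) : ℕ := (oddSquareTuples k n).ncard

/-!
Write `R(m)` for the number of representations of `8m+4` by four positive odd squares, `σ(m)` for
the sum of the divisors of `2m+1`, and `t_j = j(j+1)/2`, so that `(2j+1)² = 8 t_j + 1`. Both
functions satisfy the recurrence
`∑_{j ≥ 0, t_j ≤ m} (m - 5 t_j) f(m - t_j) = 0`,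
whose term at `j = 0` is `m f(m)`. Hence `f` is determined by `f(0)`, and `R(0) = σ(0) = 1`.

For `R`, put `n = 8m+5` and sum `n - 5 x₀²` over all representations `n = x₀² + ⋯ + x₄²` by positive
odd squares: the sum vanishes because the five coordinates play the same role
(`sum_sub_mul_sq_oddSquareTuples_eq_zero`). Grouping by `x₀ = 2j+1` gives the recurrence.

For `σ`, grouping by `x = 2j+1` turns the recurrence into `∑ y (yz - x²) = 0`, over the solutions of
`x² + 4yz = n` with `x, y, z > 0`. By the symmetries `x ↦ -x` and `y ↔ z` it is enough to prove, over
the solutions with `y, z > 0` and `x` any integer, that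
`(y + z)(y - x)(z + x) = (y + z)(yz - x²) + x (y² - z²)`
sums to zero. Since `n` is not a square, `y ≠ x + z` for every solution. On the half `x + z < y` the
involution `(x, y, z) ↦ (-(x + 2z), y - x - z, z)`, of the kind used by Zagier for sums of two
squares, replaces `y + z`, `y - x`, `z + x` by `y - x`, `y + z`, `-(z + x)` and so changes the sign
of the product. The symmetry `(x, y, z) ↦ (-x, z, y)`, which preserves the product, carries this to
the other half (`sum_zagierTriples_cubic_eq_zero`).
-/

/-! ### A recurrence along the triangular numbers -/

open Finset in
/-- The term `j = 0` of the recurrence is `m * f m`, so a solution is determined by its value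
at `0`. -/
theorem eq_of_triangular_recurrence {f g : ℕ → ℤ}
    (hf : ∀ m : ℕ, ∑ j ∈ range (m + 1) with j * (j + 1) / 2 ≤ m,
      ((m : ℤ) - 5 * (j * (j + 1) / 2 : ℕ)) * f (m - j * (j + 1) / 2) = 0)
    (hg : ∀ m : ℕ, ∑ j ∈ range (m + 1) with j * (j + 1) / 2 ≤ m,
      ((m : ℤ) - 5 * (j * (j + 1) / 2 : ℕ)) * g (m - j * (j + 1) / 2) = 0)
    (h0 : f 0 = g 0) (m : ℕ) : f m = g m := by
  induction m using Nat.strong_induction_on with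
  | _ m ih =>
  rcases Nat.eq_zero_or_pos m with rfl | hm
  · exact h0
  have hmem : 0 ∈ (range (m + 1)).filter (fun j => j * (j + 1) / 2 ≤ m) := by simp
  have e1 := hf m
  have e2 := hg m
  rw [← add_sum_erase _ _ hmem] at e1 e2
  have hrest : ∑ j ∈ ((range (m + 1)).filter (fun j => j * (j + 1) / 2 ≤ m)).erase 0,
      ((m : ℤ) - 5 * (j * (j + 1) / 2 : ℕ)) * f (m - j * (j + 1) / 2) =
      ∑ j ∈ ((range (m + 1)).filter (fun j => j * (j + 1) / 2 ≤ m)).erase 0,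
      ((m : ℤ) - 5 * (j * (j + 1) / 2 : ℕ)) * g (m - j * (j + 1) / 2) := by
    refine sum_congr rfl fun j hj => ?_
    have hj0 : 1 ≤ j := Nat.one_le_iff_ne_zero.2 (mem_erase.1 hj).1
    have : 1 ≤ j * (j + 1) / 2 := by
      rw [Nat.le_div_iff_mul_le two_pos]; nlinarith
    rw [ih _ (by omega)]
  rw [hrest] at e1
  have h := add_right_cancel (e1.trans e2.symm)
  simpa [hm.ne'] using h

theorem odd_sq_eq (j : ℕ) : (2 * j + 1) ^ 2 = 8 * (j * (j + 1) / 2) + 1 := by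
  have h : 2 * (j * (j + 1) / 2) = j * (j + 1) :=
    Nat.mul_div_cancel' (Nat.even_mul_succ_self j).two_dvd
  nlinarith

/-! ### Representations by odd squares -/

theorem mem_posCongr_one_two {x : ℕ} : x ∈ posCongr 1 2 ↔ x % 2 = 1 := by
  simp only [posCongr, Nat.ModEq, Set.mem_ofPred_eq]
  omega

/-- All coordinates contribute equally to `∑ x, ∑ i, x i ^ 2`, which is `n` times the number of
tuples. -/
theorem sum_sub_mul_sq_oddSquareTuples_eq_zero (n : ℕ) :
    ∑ x ∈ (oddSquareTuples_finite 5 n).toFinset, ((n : ℤ) - 5 * (x 0 : ℤ) ^ 2) = 0 := by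
  set T := (oddSquareTuples_finite 5 n).toFinset with hT
  have hsym : ∀ i : Fin 5, ∑ x ∈ T, (x i : ℤ) ^ 2 = ∑ x ∈ T, (x 0 : ℤ) ^ 2 := by
    intro i
    refine Finset.sum_nbij' (fun x => x ∘ Equiv.swap 0 i) (fun x => x ∘ Equiv.swap 0 i)
      ?_ ?_ ?_ ?_ ?_
    · intro x hx
      rw [hT, Set.Finite.mem_toFinset] at hx ⊢
      exact ⟨fun k => hx.1 _, hx.2.trans (Equiv.sum_comp (Equiv.swap 0 i) fun k => x k ^ 2).symm⟩
    · intro x hx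
      rw [hT, Set.Finite.mem_toFinset] at hx ⊢
      exact ⟨fun k => hx.1 _, hx.2.trans (Equiv.sum_comp (Equiv.swap 0 i) fun k => x k ^ 2).symm⟩
    · intro x _; funext k; simp
    · intro x _; funext k; simp
    · intro x _; simp
  have htot : ∑ x ∈ T, (n : ℤ) = ∑ i : Fin 5, ∑ x ∈ T, (x i : ℤ) ^ 2 := by
    rw [Finset.sum_comm]
    refine Finset.sum_congr rfl fun x hx => ?_
    rw [hT, Set.Finite.mem_toFinset] at hx
    exact_mod_cast hx.2
  rw [Finset.sum_sub_distrib, htot, Finset.sum_congr rfl fun i _ => hsym i, ← Finset.mul_sum]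
  simp

/-- Removing the first coordinate `2 * j + 1` from a tuple of five leaves a tuple of four. -/
theorem card_filter_oddSquareTuples_five {m j : ℕ} (hj : j * (j + 1) / 2 ≤ m) :
    ((oddSquareTuples_finite 5 (8 * m + 5)).toFinset.filter (fun x => x 0 / 2 = j)).card =
      oddSquareRep 4 (8 * (m - j * (j + 1) / 2) + 4) := by
  have hsq := odd_sq_eq j
  rw [oddSquareRep, Set.ncard_eq_toFinset_card _ (oddSquareTuples_finite _ _)]
  refine Finset.card_nbij' (fun x => Fin.tail x)
    (fun y => (Fin.cons (2 * j + 1) y : Fin 5 → ℕ)) ?_ ?_ ?_ ?_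
  · intro x hx
    simp only [Finset.coe_filter, Set.Finite.mem_toFinset, Set.mem_ofPred_eq] at hx
    obtain ⟨⟨h1, h2⟩, h3⟩ := hx
    simp only [Set.Finite.coe_toFinset]
    refine ⟨fun i => h1 i.succ, ?_⟩
    have h0 := mem_posCongr_one_two.1 (h1 0)
    have hx0 : x 0 = 2 * j + 1 := by omega
    rw [Fin.sum_univ_succ, hx0, hsq] at h2
    simp only [Fin.tail]
    omega
  · intro y hy
    simp only [Set.Finite.coe_toFinset] at hy
    simp only [Finset.coe_filter, Set.Finite.mem_toFinset, Set.mem_ofPred_eq]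
    refine ⟨⟨fun i => ?_, ?_⟩, ?_⟩
    · refine Fin.cases ?_ (fun i => ?_) i
      · rw [Fin.cons_zero, mem_posCongr_one_two]; omega
      · rw [Fin.cons_succ]; exact hy.1 i
    · rw [Fin.sum_univ_succ]
      simp only [Fin.cons_zero, Fin.cons_succ, hsq]
      have := hy.2
      omega
    · rw [Fin.cons_zero]; omega
  · intro x hx
    simp only [Finset.coe_filter, Set.Finite.mem_toFinset, Set.mem_ofPred_eq] at hx
    obtain ⟨⟨h1, h2⟩, h3⟩ := hx
    have h0 := mem_posCongr_one_two.1 (h1 0)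
    have hx0 : 2 * j + 1 = x 0 := by omega
    simp only [hx0, Fin.cons_self_tail]
  · intro y _
    simp only [Fin.tail_cons]

theorem oddSquareRep_four_recurrence (m : ℕ) :
    ∑ j ∈ Finset.range (m + 1) with j * (j + 1) / 2 ≤ m,
      ((m : ℤ) - 5 * (j * (j + 1) / 2 : ℕ)) *
        (oddSquareRep 4 (8 * (m - j * (j + 1) / 2) + 4) : ℤ) = 0 := by
  have h := sum_sub_mul_sq_oddSquareTuples_eq_zero (8 * m + 5)
  have hodd : ∀ x ∈ (oddSquareTuples_finite 5 (8 * m + 5)).toFinset,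
      x 0 = 2 * (x 0 / 2) + 1 := by
    intro x hx
    rw [Set.Finite.mem_toFinset] at hx
    have := mem_posCongr_one_two.1 (hx.1 0)
    omega
  rw [← Finset.sum_fiberwise_of_maps_to (g := fun x : Fin 5 → ℕ => x 0 / 2)
    (t := (Finset.range (m + 1)).filter (fun j => j * (j + 1) / 2 ≤ m))] at h
  · have key : ∀ j ∈ (Finset.range (m + 1)).filter (fun j => j * (j + 1) / 2 ≤ m),
        ∑ x ∈ (oddSquareTuples_finite 5 (8 * m + 5)).toFinset with x 0 / 2 = j,
          (((8 * m + 5 : ℕ) : ℤ) - 5 * (x 0 : ℤ) ^ 2) =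
        8 * (((m : ℤ) - 5 * (j * (j + 1) / 2 : ℕ)) *
          (oddSquareRep 4 (8 * (m - j * (j + 1) / 2) + 4) : ℤ)) := by
      intro j hj
      rw [← card_filter_oddSquareTuples_five (Finset.mem_filter.1 hj).2,
        mul_comm _ (Finset.card _ : ℤ), mul_left_comm, ← nsmul_eq_mul, ← Finset.sum_const]
      refine Finset.sum_congr rfl fun x hx => ?_
      obtain ⟨hxT, rfl⟩ := Finset.mem_filter.1 hx
      have e := odd_sq_eq (x 0 / 2)
      rw [← hodd x hxT] at e
      zify at e
      rw [e]
      push_cast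
      ring
    rw [Finset.sum_congr rfl key, ← Finset.mul_sum] at h
    simpa using h
  · intro x hx
    have e := odd_sq_eq (x 0 / 2)
    rw [← hodd x hx] at e
    have hx' := hodd x hx
    rw [Set.Finite.mem_toFinset] at hx
    have h1 : x 0 ^ 2 ≤ ∑ j, x j ^ 2 :=
      Finset.single_le_sum (f := fun j => x j ^ 2) (fun _ _ => Nat.zero_le _) (Finset.mem_univ 0)
    rw [← hx.2] at h1
    have h2 : x 0 / 2 ≤ x 0 / 2 * (x 0 / 2 + 1) / 2 := by
      rcases Nat.eq_zero_or_pos (x 0 / 2) with h0 | h0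
      · rw [h0]
      · rw [Nat.le_div_iff_mul_le two_pos]; nlinarith
    simp only [Finset.mem_filter, Finset.mem_range]
    omega

/-! ### The solutions of `x² + 4yz = n` and Zagier's involution -/

/-- The integer solutions `(x, y, z)` of `x² + 4yz = n` with `y` and `z` positive and `x` of any
sign. The bounds on the coordinates follow from these conditions and only make the set finite. -/
noncomputable def zagierTriples (n : ℤ) : Finset (ℤ × ℤ × ℤ) :=
  (Finset.Icc (-n) n ×ˢ Finset.Icc 1 n ×ˢ Finset.Icc 1 n).filter
    (fun p => p.1 ^ 2 + 4 * p.2.1 * p.2.2 = n)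

theorem mem_zagierTriples {n x y z : ℤ} :
    (x, y, z) ∈ zagierTriples n ↔ 0 < y ∧ 0 < z ∧ x ^ 2 + 4 * y * z = n := by
  simp only [zagierTriples, Finset.mem_filter, Finset.mem_product, Finset.mem_Icc]
  constructor
  · rintro ⟨⟨-, ⟨h1, -⟩, h2, -⟩, h⟩
    exact ⟨by omega, by omega, h⟩
  · rintro ⟨h1, h2, h⟩
    have hyz : 0 < y * z := mul_pos h1 h2
    refine ⟨⟨⟨?_, ?_⟩, ⟨?_, ?_⟩, ?_, ?_⟩, h⟩ <;> nlinarith [sq_nonneg (x - 1), sq_nonneg (x + 1)]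

/-- The cubic `(y + z)(y - x)(z + x)` changes sign under an involution of the solutions; `n` must not
be a square since `y = x + z` would give `n = (x + 2 * z) ^ 2`, and such a solution has no image. -/
theorem sum_zagierTriples_cubic_eq_zero {n : ℤ} (hn : ¬ IsSquare n) :
    ∑ p ∈ zagierTriples n, (p.2.1 + p.2.2) * (p.2.1 - p.1) * (p.2.2 + p.1) = 0 := by
  -- The second branch is the first one conjugated by `(x, y, z) ↦ (-x, z, y)`.
  refine Finset.sum_involution
    (fun p _ => if p.1 + p.2.2 < p.2.1 then (-(p.1 + 2 * p.2.2), p.2.1 - p.1 - p.2.2, p.2.2)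
      else (2 * p.2.1 - p.1, p.2.1, p.2.2 + p.1 - p.2.1)) ?_ ?_ ?_ ?_
  · rintro ⟨x, y, z⟩ hp
    dsimp only
    split_ifs <;> ring
  · rintro ⟨x, y, z⟩ hp hne heq
    apply hne
    dsimp only at heq ⊢
    split_ifs at heq
    · have h1 : z + x = 0 := by
        have := congrArg Prod.fst heq; dsimp only at this; omega
      rw [h1, mul_zero]
    · have h1 : y - x = 0 := by
        have := congrArg Prod.fst heq; dsimp only at this; omega
      rw [h1, mul_zero, zero_mul]
  · rintro ⟨x, y, z⟩ hp
    rw [mem_zagierTriples] at hp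
    obtain ⟨hy, hz, h⟩ := hp
    dsimp only
    split_ifs with hlt
    · rw [mem_zagierTriples]
      exact ⟨by omega, hz, by rw [← h]; ring⟩
    · rw [mem_zagierTriples]
      have hne : y ≠ x + z := by
        rintro rfl
        exact hn ⟨x + 2 * z, by rw [← h]; ring⟩
      exact ⟨hy, by omega, by rw [← h]; ring⟩
  · rintro ⟨x, y, z⟩ hp
    rw [mem_zagierTriples] at hp
    obtain ⟨hy, hz, h⟩ := hp
    dsimp only
    by_cases hlt : x + z < y
    · have h2 : -(x + 2 * z) + z < y - x - z := by omega
      rw [if_pos hlt]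
      dsimp only
      rw [if_pos h2]
      ext <;> dsimp only <;> ring
    · have h2 : ¬ 2 * y - x + (z + x - y) < y := by omega
      rw [if_neg hlt]
      dsimp only
      rw [if_neg h2]
      ext <;> dsimp only <;> ring

theorem sum_zagierTriples_eq_zero {n : ℤ} (hn : ¬ IsSquare n) :
    ∑ p ∈ zagierTriples n, p.2.1 * (p.2.1 * p.2.2 - p.1 ^ 2) = 0 := by
  -- The antisymmetric part of the cubic cancels under `x ↦ -x`.
  have hodd : ∑ p ∈ zagierTriples n, p.1 * (p.2.1 ^ 2 - p.2.2 ^ 2) = 0 := by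
    refine Finset.sum_involution (fun p _ => (-p.1, p.2)) ?_ ?_ ?_ ?_
    · rintro ⟨x, y, z⟩ _; dsimp only; ring
    · rintro ⟨x, y, z⟩ _ hne heq
      apply hne
      have h1 : x = 0 := by
        have := congrArg Prod.fst heq; dsimp only at this; omega
      dsimp only
      rw [h1, zero_mul]
    · rintro ⟨x, y, z⟩ hp
      rw [mem_zagierTriples] at hp
      simpa [mem_zagierTriples] using hp
    · rintro ⟨x, y, z⟩ _; simp
  have hswap : ∑ p ∈ zagierTriples n, p.2.2 * (p.2.1 * p.2.2 - p.1 ^ 2) =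
      ∑ p ∈ zagierTriples n, p.2.1 * (p.2.1 * p.2.2 - p.1 ^ 2) := by
    refine Finset.sum_nbij' (fun p => (p.1, p.2.2, p.2.1)) (fun p => (p.1, p.2.2, p.2.1))
      ?_ ?_ (fun _ _ => rfl) (fun _ _ => rfl) ?_
    · rintro ⟨x, y, z⟩ hp
      rw [mem_zagierTriples] at hp ⊢
      exact ⟨hp.2.1, hp.1, by linarith [hp.2.2]⟩
    · rintro ⟨x, y, z⟩ hp
      rw [mem_zagierTriples] at hp ⊢
      exact ⟨hp.2.1, hp.1, by linarith [hp.2.2]⟩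
    · rintro ⟨x, y, z⟩ _; dsimp only; ring
  have hsum : ∑ p ∈ zagierTriples n, (p.2.1 + p.2.2) * (p.2.1 - p.1) * (p.2.2 + p.1) =
      ∑ p ∈ zagierTriples n, p.2.1 * (p.2.1 * p.2.2 - p.1 ^ 2) +
      ∑ p ∈ zagierTriples n, p.2.2 * (p.2.1 * p.2.2 - p.1 ^ 2) +
      ∑ p ∈ zagierTriples n, p.1 * (p.2.1 ^ 2 - p.2.2 ^ 2) := by
    rw [← Finset.sum_add_distrib, ← Finset.sum_add_distrib]
    exact Finset.sum_congr rfl fun p _ => by ring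
  rw [sum_zagierTriples_cubic_eq_zero hn, hodd, hswap] at hsum
  omega

/-- For `n` odd no solution has `x = 0`, so `x ↦ -x` halves the sum. -/
theorem sum_pos_zagierTriples_eq_zero {n : ℤ} (hn : ¬ IsSquare n) (hodd : Odd n) :
    ∑ p ∈ zagierTriples n with 0 < p.1, p.2.1 * (p.2.1 * p.2.2 - p.1 ^ 2) = 0 := by
  have hneg : ∑ p ∈ zagierTriples n with ¬ 0 < p.1, p.2.1 * (p.2.1 * p.2.2 - p.1 ^ 2) =
      ∑ p ∈ zagierTriples n with 0 < p.1, p.2.1 * (p.2.1 * p.2.2 - p.1 ^ 2) := by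
    refine Finset.sum_nbij' (fun p => (-p.1, p.2)) (fun p => (-p.1, p.2))
      ?_ ?_ (fun _ _ => by simp) (fun _ _ => by simp) ?_
    · rintro ⟨x, y, z⟩ hp
      rw [Finset.mem_filter, mem_zagierTriples] at hp ⊢
      have hx : x ≠ 0 := by
        rintro rfl
        obtain ⟨k, hk⟩ := hodd
        have := hp.1.2.2
        rw [mul_assoc] at this
        omega
      dsimp only at hp ⊢
      exact ⟨⟨hp.1.1, hp.1.2.1, by rw [← hp.1.2.2]; ring⟩, by omega⟩
    · rintro ⟨x, y, z⟩ hp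
      rw [Finset.mem_filter, mem_zagierTriples] at hp ⊢
      dsimp only at hp ⊢
      exact ⟨⟨hp.1.1, hp.1.2.1, by rw [← hp.1.2.2]; ring⟩, by omega⟩
    · rintro ⟨x, y, z⟩ _; dsimp only; ring
  have h := Finset.sum_filter_add_sum_filter_not (zagierTriples n) (fun p => 0 < p.1)
    (fun p => p.2.1 * (p.2.1 * p.2.2 - p.1 ^ 2))
  rw [sum_zagierTriples_eq_zero hn, hneg] at h
  omega

/-! ### The recurrence for the divisor sum -/

theorem not_isSquare_of_emod_eight_eq_five {n : ℤ} (h : n % 8 = 5) : ¬ IsSquare n := by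
  rintro ⟨a, rfl⟩
  have : a % 8 = 0 ∨ a % 8 = 1 ∨ a % 8 = 2 ∨ a % 8 = 3 ∨ a % 8 = 4 ∨ a % 8 = 5 ∨ a % 8 = 6 ∨
    a % 8 = 7 := by omega
  rcases this with h1 | h1 | h1 | h1 | h1 | h1 | h1 | h1 <;> simp [Int.mul_emod, h1] at h

/-- The solutions of `x² + 4yz = 8m + 5` with `x = 2 * j + 1` are the factorizations `y * z` of
`2 * (m - j * (j + 1) / 2) + 1`. -/
theorem sum_fiber_zagierTriples {m j : ℕ} (hj : j * (j + 1) / 2 ≤ m) :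
    ∑ p ∈ (zagierTriples (8 * m + 5)).filter (fun p => 0 < p.1) with (p.1 / 2).toNat = j,
      p.2.1 = ∑ d ∈ (2 * (m - j * (j + 1) / 2) + 1).divisors, (d : ℤ) := by
  have hsq := odd_sq_eq j
  obtain ⟨r, hr⟩ := Nat.exists_eq_add_of_le hj
  have hr' : m - j * (j + 1) / 2 = r := by omega
  rw [hr', ← Nat.sum_divisorsAntidiagonal (n := 2 * r + 1) (f := fun d _ => (d : ℤ))]
  have hfib : ∀ x y z : ℤ, (x, y, z) ∈ ((zagierTriples (8 * m + 5)).filter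
      (fun p => 0 < p.1)).filter (fun p => (p.1 / 2).toNat = j) ↔
      x = 2 * j + 1 ∧ 0 < y ∧ 0 < z ∧ y * z = 2 * r + 1 := by
    intro x y z
    have hm : (m : ℤ) = (j * (j + 1) / 2 : ℕ) + r := by exact_mod_cast hr
    have hsq' : (2 * (j : ℤ) + 1) ^ 2 = 8 * (j * (j + 1) / 2 : ℕ) + 1 := by exact_mod_cast hsq
    simp only [Finset.mem_filter, mem_zagierTriples]
    constructor
    · rintro ⟨⟨⟨hy, hz, h⟩, hx⟩, hxj⟩
      have hx2 : x % 2 = 1 := by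
        rcases Int.emod_two_eq_zero_or_one x with h0 | h0
        · obtain ⟨k, rfl⟩ : ∃ k, x = 2 * k := ⟨x / 2, by omega⟩
          have : (2 * k) ^ 2 + 4 * y * z = 2 * (2 * k ^ 2 + 2 * y * z) := by ring
          omega
        · exact h0
      have hx' : x = 2 * j + 1 := by omega
      refine ⟨hx', hy, hz, ?_⟩
      rw [hx', hsq', mul_assoc] at h
      omega
    · rintro ⟨rfl, hy, hz, h⟩
      refine ⟨⟨⟨hy, hz, ?_⟩, by omega⟩, by omega⟩
      rw [mul_assoc, h, hsq', hm]
      ring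
  refine Finset.sum_nbij' (fun p => (p.2.1.toNat, p.2.2.toNat))
    (fun q => ((2 * j + 1 : ℤ), (q.1 : ℤ), (q.2 : ℤ))) ?_ ?_ ?_ ?_ ?_
  · rintro ⟨x, y, z⟩ hp
    obtain ⟨-, hy, hz, h⟩ := (hfib x y z).1 hp
    rw [Nat.mem_divisorsAntidiagonal]
    refine ⟨?_, by omega⟩
    zify
    rw [Int.toNat_of_nonneg hy.le, Int.toNat_of_nonneg hz.le, h]
  · rintro ⟨a, b⟩ hq
    obtain ⟨h, -⟩ := Nat.mem_divisorsAntidiagonal.1 hq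
    rw [hfib]
    dsimp only at h
    have ha : a ≠ 0 := by rintro rfl; omega
    have hb : b ≠ 0 := by rintro rfl; omega
    exact ⟨rfl, by omega, by omega, by exact_mod_cast h⟩
  · rintro ⟨x, y, z⟩ hp
    obtain ⟨hx, hy, hz, h⟩ := (hfib x y z).1 hp
    simp only [Int.toNat_of_nonneg hy.le, Int.toNat_of_nonneg hz.le, hx]
  · rintro ⟨a, b⟩ _; simp
  · rintro ⟨x, y, z⟩ hp
    obtain ⟨hx, hy, hz, h⟩ := (hfib x y z).1 hp
    simp only [Int.toNat_of_nonneg hy.le]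

theorem sum_divisors_recurrence (m : ℕ) :
    ∑ j ∈ Finset.range (m + 1) with j * (j + 1) / 2 ≤ m,
      ((m : ℤ) - 5 * (j * (j + 1) / 2 : ℕ)) *
        ∑ d ∈ (2 * (m - j * (j + 1) / 2) + 1).divisors, (d : ℤ) = 0 := by
  have h := sum_pos_zagierTriples_eq_zero (n := 8 * m + 5)
    (not_isSquare_of_emod_eight_eq_five (by omega)) ⟨4 * m + 2, by ring⟩
  have hodd : ∀ p ∈ (zagierTriples (8 * m + 5)).filter (fun p => 0 < p.1),
      p.1 = 2 * ((p.1 / 2).toNat : ℤ) + 1 := by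
    rintro ⟨x, y, z⟩ hp
    rw [Finset.mem_filter, mem_zagierTriples] at hp
    obtain ⟨⟨hy, hz, h⟩, hx⟩ := hp
    dsimp only at hx ⊢
    rcases Int.emod_two_eq_zero_or_one x with h0 | h0
    · obtain ⟨k, rfl⟩ : ∃ k, x = 2 * k := ⟨x / 2, by omega⟩
      have : (2 * k) ^ 2 + 4 * y * z = 2 * (2 * k ^ 2 + 2 * y * z) := by ring
      omega
    · omega
  rw [← Finset.sum_fiberwise_of_maps_to (g := fun p : ℤ × ℤ × ℤ => (p.1 / 2).toNat)
    (t := (Finset.range (m + 1)).filter (fun j => j * (j + 1) / 2 ≤ m))] at h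
  · have key : ∀ j ∈ (Finset.range (m + 1)).filter (fun j => j * (j + 1) / 2 ≤ m),
        ∑ p ∈ (zagierTriples (8 * m + 5)).filter (fun p => 0 < p.1) with (p.1 / 2).toNat = j,
          p.2.1 * (p.2.1 * p.2.2 - p.1 ^ 2) =
        2 * (((m : ℤ) - 5 * (j * (j + 1) / 2 : ℕ)) *
          ∑ d ∈ (2 * (m - j * (j + 1) / 2) + 1).divisors, (d : ℤ)) := by
      intro j hj
      rw [← sum_fiber_zagierTriples (Finset.mem_filter.1 hj).2, Finset.mul_sum, Finset.mul_sum]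
      refine Finset.sum_congr rfl fun p hp => ?_
      obtain ⟨hpS, rfl⟩ := Finset.mem_filter.1 hp
      have e := odd_sq_eq (p.1 / 2).toNat
      zify at e
      rw [← hodd p hpS] at e
      have h4 := (mem_zagierTriples.1 (Finset.mem_filter.1 hpS).1).2.2
      have h5 : p.2.1 * p.2.2 - p.1 ^ 2 = 2 * ((m : ℤ) - 5 *
          ((p.1 / 2).toNat * ((p.1 / 2).toNat + 1) / 2 : ℕ)) := by
        push_cast
        linarith
      rw [h5]
      ring
    rw [Finset.sum_congr rfl key, ← Finset.mul_sum] at h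
    simpa using h
  · intro p hp
    have e := odd_sq_eq (p.1 / 2).toNat
    have hp' := hodd p hp
    obtain ⟨h1, h2, h3⟩ := mem_zagierTriples.1 (Finset.mem_filter.1 hp).1
    have h4 : 0 < p.2.1 * p.2.2 := mul_pos h1 h2
    have e' : p.1 ^ 2 = 8 * ((p.1 / 2).toNat * ((p.1 / 2).toNat + 1) / 2 : ℕ) + 1 := by
      zify at e
      rwa [← hp'] at e
    clear e hp'
    generalize (p.1 / 2).toNat = i at *
    generalize ht : i * (i + 1) / 2 = t at *
    have h5 : i ≤ t := by
      rw [← ht]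
      rcases Nat.eq_zero_or_pos i with h0 | h0
      · rw [h0]
      · rw [Nat.le_div_iff_mul_le two_pos]; nlinarith
    simp only [Finset.mem_filter, Finset.mem_range]
    have h6 : (t : ℤ) ≤ m := by nlinarith
    omega

/-! ### Counting the representations -/

theorem mainTheorem5 (m : ℕ) :
    oddSquareRep 4 (8 * m + 4) = ∑ d ∈ (2 * m + 1).divisors, d := by
  have h := eq_of_triangular_recurrence
    (f := fun m => (oddSquareRep 4 (8 * m + 4) : ℤ))
    (g := fun m => ∑ d ∈ (2 * m + 1).divisors, (d : ℤ))
    oddSquareRep_four_recurrence sum_divisors_recurrence ?_ m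
  · zify
    exact h
  -- Four positive odd squares with sum `4` are all equal to `1`.
  · have hset : oddSquareTuples 4 4 = {fun _ => 1} := by
      ext x
      simp only [oddSquareTuples, Set.mem_ofPred_eq, Set.mem_singleton_iff, mem_posCongr_one_two]
      constructor
      · rintro ⟨h1, h2⟩
        have hp : ∀ i, 1 ≤ x i ^ 2 := fun i => Nat.one_le_pow _ _ (by have := h1 i; omega)
        have hs : ∑ i, x i ^ 2 = ∑ i : Fin 4, 1 := by simp [← h2]
        funext i
        have := (Finset.sum_eq_sum_iff_of_le fun i _ => hp i).1 hs.symm i (Finset.mem_univ i)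
        exact (Nat.pow_eq_one.1 this.symm).resolve_right two_ne_zero
      · rintro rfl
        simp
    simp [oddSquareRep, hset]
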